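/- Let $R$ be a noetherian local ring with maximal ideal $\mathfrak{m}_R$ whose formal completion $\hat{R}=\varprojlim_n R/\mathfrak{m}_R^n$ is an integral domain; regard $R$ as a subring of $\hat{R}$ via the canonical map. Let $p\geq 1$ be the characteristic exponent of the fields of fractions $\operatorname{Frac}(R)\subset\operatorname{Frac}(\hat{R})$ (that is, $p=1$ in characteristic zero, and $p$ is the characteristic otherwise), and let $$R^{\mathrm{prc}}=\{b\in\hat{R}\mid b^{p^\nu}\in R \text{ for some } \nu\geq 0\}$$ be the $p$-radical closure of $R$, a subring of $\hat{R}$ containing $R$. Suppose $\dim(R)=1$. Then every intermediate ring $R\subsetneqq A\subset R^{\mathrm{prc}}$ that is finitely generated as an $R$-module is an integral local noetherian ring with $\dim(A)=1$, and its normalization $A\subset A'$ (the integral closure of $A$ in its field of fractions) is not a finite extension, that is, $A'$ is not a finitely generated $A$-module. -/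

import Mathlib

open IsLocalRing

/-- The formal completion of a local ring: the inverse limit of the rings `R / 𝔪 ^ n`. -/
abbrev FormalCompletion (R : Type*) [CommRing R] [IsLocalRing R] : Type _ :=
  AdicCompletion (maximalIdeal R) R

/-- The characteristic exponent of the field of fractions of the formal completion, assuming that
the latter is a domain: `1` in characteristic zero, and the characteristic otherwise. -/
noncomputable def formalCharExponent (R : Type*) [CommRing R] [IsLocalRing R] : ℕ :=
  ringExpChar (FractionRing (FormalCompletion R))

theorem expChar_formalCompletion (R : Type*) [CommRing R] [IsLocalRing R]
    [IsDomain (FormalCompletion R)] :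
    ExpChar (FormalCompletion R) (formalCharExponent R) := by
  have h : ExpChar (FractionRing (FormalCompletion R)) (formalCharExponent R) :=
    ringExpChar.expChar _
  exact RingHom.expChar (algebraMap (FormalCompletion R) (FractionRing (FormalCompletion R)))
    (IsFractionRing.injective _ _) _

/-- The `p`-radical closure of a formally integral local ring `R`: all elements `b` of the formal
completion such that `b ^ p ^ ν` lies in (the image of) `R` for some `ν ≥ 0`, where `p` is
the characteristic exponent of the fields of fractions. -/
noncomputable def pRadicalClosure (R : Type*) [CommRing R] [IsLocalRing R]
    [IsDomain (FormalCompletion R)] : Subalgebra R (FormalCompletion R) where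
  carrier := {b | ∃ ν : ℕ, ∃ a : R,
    b ^ formalCharExponent R ^ ν = algebraMap R (FormalCompletion R) a}
  mul_mem' := by
    rintro x y ⟨m, a, ha⟩ ⟨n, b, hb⟩
    refine ⟨m + n, a ^ formalCharExponent R ^ n * b ^ formalCharExponent R ^ m, ?_⟩
    rw [map_mul, map_pow, map_pow, ← ha, ← hb, mul_pow]
    ring
  add_mem' := by
    rintro x y ⟨m, a, ha⟩ ⟨n, b, hb⟩
    have := expChar_formalCompletion R
    refine ⟨m + n, a ^ formalCharExponent R ^ n + b ^ formalCharExponent R ^ m, ?_⟩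
    rw [map_add, map_pow, map_pow, ← ha, ← hb, add_pow_expChar_pow]
    ring
  algebraMap_mem' a := ⟨0, a, by simp⟩

/-! Suppose the normalization `B` of `A` is finite over `A`. Then `B` is a Dedekind domain, finite
over `R`. For `a` in `A` with `a ^ q = c` in `R`, `q` a power of `p`, choose `r` in `R` agreeing
with `a` modulo `𝔪 ^ n`. By Frobenius `(a - r) ^ q = c - r ^ q` lies in `R`, hence in `𝔪 ^ (n * q)`.
Factorization of ideals in `B` permits taking `q`-th roots, so `a - r ∈ 𝔪 ^ n B`. Krull's
intersection theorem for `B / R` then gives `a ∈ R`, so `A = R`, a contradiction. -/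

/-- The `q`-th power of an element of the completion that vanishes modulo `I ^ n`
vanishes modulo `I ^ (n * q)`. -/
theorem AdicCompletion.evalₐ_pow_eq_zero {R : Type*} [CommRing R] (I : Ideal R) {n q : ℕ}
    (hq : q ≠ 0) (y : AdicCompletion I R) (h : AdicCompletion.evalₐ I n y = 0) :
    AdicCompletion.evalₐ I (n * q) (y ^ q) = 0 := by
  obtain ⟨f, rfl⟩ := AdicCompletion.mk_surjective I R y
  -- The representative at level `n * q` already lies in `I ^ n`, by compatibility with level `n`.
  rw [AdicCompletion.evalₐ_mk, ← AdicCompletion.Ideal.mk_eq_mk I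
    (Nat.le_mul_of_pos_right n (Nat.pos_of_ne_zero hq)) f, Ideal.Quotient.eq_zero_iff_mem] at h
  rw [map_pow, AdicCompletion.evalₐ_mk, ← map_pow, Ideal.Quotient.eq_zero_iff_mem, pow_mul]
  exact Ideal.pow_mem_pow h q

/-- In a module-finite Dedekind extension `B` of a noetherian local ring `R`, an element lies in
`R` as soon as it is approximated by elements of `R` up to `q`-th powers. -/
theorem IsDedekindDomain.mem_range_algebraMap_of_pow_sub_mem {R B : Type*} [CommRing R]
    [IsLocalRing R] [IsNoetherianRing R] [CommRing B] [IsDedekindDomain B] [Algebra R B]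
    [Module.Finite R B] {q : ℕ} (hq : q ≠ 0) (x : B)
    (h : ∀ n : ℕ, ∃ r : R, ∃ t ∈ maximalIdeal R ^ (n * q),
      (x - algebraMap R B r) ^ q = algebraMap R B t) :
    x ∈ Set.range (algebraMap R B) := by
  have key : ∀ n : ℕ, ∃ r : R,
      x - algebraMap R B r ∈ (maximalIdeal R ^ n • ⊤ : Submodule R B) := by
    intro n
    obtain ⟨r, t, ht, hrt⟩ := h n
    refine ⟨r, ?_⟩
    -- Containment is divisibility of ideals in `B`, so the exponent `q` can be cancelled.
    rw [Ideal.smul_top_eq_map, Submodule.restrictScalars_mem, ← Ideal.dvd_span_singleton,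
      ← UniqueFactorizationMonoid.pow_dvd_pow_iff_dvd hq, Ideal.span_singleton_pow, hrt, Ideal.dvd_span_singleton,
      ← Ideal.map_pow, ← pow_mul]
    exact Ideal.mem_map_of_mem _ ht
  let N : Submodule R B := LinearMap.range (Algebra.linearMap R B)
  -- Krull's theorem is applied to the finite `R`-module `B ⧸ N`, where the approximants `r` vanish.
  have hx : N.mkQ x ∈ (⨅ i : ℕ, maximalIdeal R ^ i • ⊤ : Submodule R (B ⧸ N)) := by
    rw [Submodule.mem_iInf]
    intro n
    obtain ⟨r, hr⟩ := key n
    have h1 : N.mkQ x = N.mkQ (x - algebraMap R B r) := by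
      rw [← sub_eq_zero, ← map_sub, sub_sub_cancel, Submodule.mkQ_apply,
        Submodule.Quotient.mk_eq_zero]
      exact ⟨r, rfl⟩
    rw [h1]
    have h2 := Submodule.mem_map_of_mem (f := N.mkQ) hr
    rw [Submodule.map_smul''] at h2
    exact Submodule.smul_mono le_rfl le_top h2
  rw [Ideal.iInf_pow_smul_eq_bot_of_isLocalRing _ (Ideal.IsPrime.ne_top'), Submodule.mem_bot,
    Submodule.mkQ_apply, Submodule.Quotient.mk_eq_zero] at hx
  exact hx

theorem isUnit_iff_of_pow_eq_algebraMap {R A : Type*} [CommRing R] [CommRing A] [Algebra R A]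
    [Algebra.IsIntegral R A] (hinj : Function.Injective (algebraMap R A)) {a : A} {r : R} {q : ℕ}
    (hq : q ≠ 0) (h : a ^ q = algebraMap R A r) : IsUnit a ↔ IsUnit r := by
  have : FaithfulSMul R A := (faithfulSMul_iff_algebraMap_injective R A).2 hinj
  rw [← isUnit_pow_iff hq, h]
  exact isUnit_map_iff _ r

/-- A ring all of whose elements have a `p`-power in a local subring is local. -/
theorem IsLocalRing.of_pow_expChar_pow_mem {R A : Type*} [CommRing R] [IsLocalRing R]
    [CommRing A] [Nontrivial A] [Algebra R A] [Algebra.IsIntegral R A]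
    (hinj : Function.Injective (algebraMap R A)) (p : ℕ) [ExpChar A p]
    (h : ∀ a : A, ∃ ν : ℕ, ∃ r : R, a ^ p ^ ν = algebraMap R A r) : IsLocalRing A := by
  have hp (ν : ℕ) : p ^ ν ≠ 0 := (expChar_pow_pos A p ν).ne'
  refine .of_nonunits_add fun a b ha hb ↦ ?_
  obtain ⟨m, r, hr⟩ := h a
  obtain ⟨n, s, hs⟩ := h b
  rw [mem_nonunits_iff, isUnit_iff_of_pow_eq_algebraMap hinj (hp _) hr] at ha
  rw [mem_nonunits_iff, isUnit_iff_of_pow_eq_algebraMap hinj (hp _) hs] at hb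
  -- The common exponent `p ^ (m + n)` brings both powers into `R`, and Frobenius is additive.
  have hab : (a + b) ^ p ^ (m + n) = algebraMap R A (r ^ p ^ n + s ^ p ^ m) := by
    rw [map_add, map_pow, map_pow, ← hr, ← hs, add_pow_expChar_pow]
    ring
  rw [mem_nonunits_iff, isUnit_iff_of_pow_eq_algebraMap hinj (hp _) hab]
  exact IsLocalRing.nonunits_add (by simpa [mem_nonunits_iff, isUnit_pow_iff (hp _)] using ha)
    (by simpa [mem_nonunits_iff, isUnit_pow_iff (hp _)] using hb)

theorem Ring.DimensionLEOne.of_ringKrullDim_le_one {R : Type*} [CommRing R] [IsDomain R]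
    (h : ringKrullDim R ≤ 1) : Ring.DimensionLEOne R where
  maximalOfPrime {p} hp hp' :=
    Ring.krullDimLE_one_iff_of_noZeroDivisors.1 (Ring.krullDimLE_iff.2 (by simpa using h)) p hp hp'

theorem ringKrullDim_eq_one_of_not_isField {R : Type*} [CommRing R] [IsDomain R]
    [Ring.DimensionLEOne R] (h : ¬ IsField R) : ringKrullDim R = 1 := by
  refine le_antisymm
    (Ring.krullDimLE_iff.1 (inferInstance : Ring.KrullDimLE 1 R)) ?_
  by_contra! hlt
  have : Ring.KrullDimLE 0 R := Ring.krullDimLE_iff.2 (ENat.WithBot.lt_add_one_iff.mp hlt)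
  exact h Ring.KrullDimLE.isField_of_isDomain

/-- Finiteness supplies noetherianness; dimension at most one passes to integral extensions. -/
theorem integralClosure.isDedekindDomain_of_finite (A : Type*) [CommRing A] [IsDomain A]
    [IsNoetherianRing A] [Ring.DimensionLEOne A]
    [Module.Finite A (integralClosure A (FractionRing A))] :
    IsDedekindDomain (integralClosure A (FractionRing A)) := by
  have := isNoetherian_of_isNoetherianRing_of_finite A (integralClosure A (FractionRing A))
  have : IsNoetherianRing (integralClosure A (FractionRing A)) := isNoetherian_of_tower A this
  have : IsIntegrallyClosed (integralClosure A (FractionRing A)) :=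
    integralClosure.isIntegrallyClosedOfFiniteExtension (FractionRing A)
  exact {}

/-- Let `A` be a finite extension of `R` whose normalization is finite. An element of `A` lies in
`R` as soon as it is approximated by elements of `R` up to `q`-th powers. -/
theorem mem_range_algebraMap_of_finite_integralClosure {R A : Type*} [CommRing R]
    [IsLocalRing R] [IsNoetherianRing R] [CommRing A] [IsDomain A] [Algebra R A]
    [Module.Finite R A] [IsNoetherianRing A] [Ring.DimensionLEOne A]
    [Module.Finite A (integralClosure A (FractionRing A))] {q : ℕ} (hq : q ≠ 0) (x : A)
    (h : ∀ n : ℕ, ∃ r : R, ∃ t ∈ maximalIdeal R ^ (n * q),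
      (x - algebraMap R A r) ^ q = algebraMap R A t) :
    x ∈ Set.range (algebraMap R A) := by
  let B := integralClosure A (FractionRing A)
  have : IsDedekindDomain B := integralClosure.isDedekindDomain_of_finite A
  have : Module.Finite R B := Module.Finite.trans A B
  have hinj : Function.Injective (algebraMap A B) := FaithfulSMul.algebraMap_injective A B
  obtain ⟨r, hr⟩ := IsDedekindDomain.mem_range_algebraMap_of_pow_sub_mem (R := R) hq
      (algebraMap A B x) fun n ↦ by
    obtain ⟨r, t, ht, hrt⟩ := h n
    refine ⟨r, t, ht, ?_⟩
    rw [IsScalarTower.algebraMap_apply R A B, IsScalarTower.algebraMap_apply R A B, ← map_sub,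
      ← map_pow, hrt]
  rw [IsScalarTower.algebraMap_apply R A B] at hr
  exact ⟨r, hinj hr⟩

/-- Elements of the `p`-radical closure are approximated by elements of `R` up to `q`-th powers,
for a suitable power `q` of `p`. -/
theorem exists_pow_sub_eq_of_mem_pRadicalClosure {R : Type*} [CommRing R] [IsLocalRing R]
    [IsDomain (FormalCompletion R)] {a : FormalCompletion R} (ha : a ∈ pRadicalClosure R) :
    ∃ q : ℕ, q ≠ 0 ∧ ∀ n : ℕ, ∃ r : R, ∃ t ∈ maximalIdeal R ^ (n * q),
      (a - algebraMap R (FormalCompletion R) r) ^ q = algebraMap R (FormalCompletion R) t := by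
  have := expChar_formalCompletion R
  obtain ⟨ν, c, hc⟩ := ha
  have hq : formalCharExponent R ^ ν ≠ 0 :=
    (expChar_pow_pos (FormalCompletion R) (formalCharExponent R) ν).ne'
  refine ⟨_, hq, fun n ↦ ?_⟩
  obtain ⟨r, hr⟩ := Ideal.Quotient.mk_surjective (AdicCompletion.evalₐ (maximalIdeal R) n a)
  have hpow : (a - algebraMap R (FormalCompletion R) r) ^ formalCharExponent R ^ ν =
      algebraMap R (FormalCompletion R) (c - r ^ formalCharExponent R ^ ν) := by
    rw [sub_pow_expChar_pow, hc, map_sub, map_pow]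
  refine ⟨r, c - r ^ formalCharExponent R ^ ν, ?_, hpow⟩
  -- Evaluating at level `n * q` turns vanishing in the completion into membership in an ideal of
  -- `R`.
  have h0 := AdicCompletion.evalₐ_pow_eq_zero (maximalIdeal R) (n := n) hq
    (a - algebraMap R (FormalCompletion R) r) (by
      rw [map_sub, AlgHom.commutes, ← hr, Ideal.Quotient.algebraMap_eq, sub_self])
  rwa [hpow, AlgHom.commutes, Ideal.Quotient.algebraMap_eq, Ideal.Quotient.eq_zero_iff_mem] at h0

theorem corollary3p4 (R : Type*) [CommRing R] [IsLocalRing R] [IsNoetherianRing R]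
    [IsDomain (FormalCompletion R)] (hdim : ringKrullDim R = 1)
    (A : Subalgebra R (FormalCompletion R)) (hA : A ≤ pRadicalClosure R)
    (hfin : Module.Finite R A) (hne : A ≠ ⊥) :
    IsDomain A ∧ IsLocalRing A ∧ IsNoetherianRing A ∧ ringKrullDim A = 1 ∧
      ¬ Module.Finite A (integralClosure A (FractionRing A)) := by
  have hinj : Function.Injective (algebraMap R (FormalCompletion R)) :=
    AdicCompletion.of_injective (maximalIdeal R) R
  have hinjA : Function.Injective (algebraMap R A) := fun x y h ↦
    hinj (congrArg Subtype.val h)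
  have : IsDomain R := hinj.isDomain
  have : ExpChar (FormalCompletion R) (formalCharExponent R) := expChar_formalCompletion R
  have : ExpChar A (formalCharExponent R) :=
    RingHom.expChar A.val.toRingHom Subtype.val_injective _
  have hnoeth : IsNoetherianRing A :=
    isNoetherian_of_tower R (isNoetherian_of_isNoetherianRing_of_finite R A)
  have : Ring.DimensionLEOne R := .of_ringKrullDim_le_one hdim.le
  have : Ring.DimensionLEOne A := .of_isIntegral R A
  refine ⟨inferInstance, .of_pow_expChar_pow_mem hinjA (formalCharExponent R) fun a ↦ ?_, hnoeth,
    ringKrullDim_eq_one_of_not_isField fun hF ↦ ?_, fun hB ↦ ?_⟩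
  · obtain ⟨ν, r, h⟩ := hA a.2
    exact ⟨ν, r, Subtype.ext h⟩
  · have := ringKrullDim_eq_zero_of_isField (isField_of_isIntegral_of_isField hinjA hF)
    simp [hdim] at this
  · refine hne (eq_bot_iff.2 fun a ha ↦ ?_)
    obtain ⟨q, hq, h⟩ := exists_pow_sub_eq_of_mem_pRadicalClosure (hA ha)
    obtain ⟨r, hr⟩ := mem_range_algebraMap_of_finite_integralClosure (R := R) hq (⟨a, ha⟩ : A)
      fun n ↦ by
        obtain ⟨r, t, ht, hrt⟩ := h n
        exact ⟨r, t, ht, Subtype.ext hrt⟩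
    exact ⟨r, congrArg Subtype.val hr⟩
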